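/- Let $\mathbb N=\{1,2,3,\dots\}$. For $n\in\mathbb N$ let $U_n$ be the group of $n\times n$ complex unitary matrices with the bi-invariant metric $d(A,B)=\frac{1}{2\sqrt n}\|A-B\|_2$, where $\|A\|_2=(\sum_{i,j}|A_{ij}|^2)^{1/2}$. The language of bi-invariant metric groups (of diameter at most $1$) has symbols for multiplication, inverse and identity, and no relation symbol besides the metric $d$. A quantifier-free formula is built from the atomic formulas $d(s,t)$, with $s,t$ group terms, by applying continuous functions $[0,1]^k\to[0,1]$ ($k\ge 0$). Let $\varphi$ be a sentence of the form $$\inf_x\ \sup_{y_1,\dots,y_n}\psi(y_1,\dots,y_n,x),$$ where $n\ge 0$, $x,y_1,\dots,y_n$ are single variables and $\psi$ is a quantifier-free formula; such sentences are called $\Sigma_2$ here. Then the sequence of values $(\varphi^{U_k})_{k\in\mathbb N}$ converges. Consequently, all universal hyperlinear groups have the same metric $\Sigma_2$-theory: if $\mathcal U,\mathcal V$ are nonprincipal ultrafilters on $\mathbb N$ and $\prod_k^{\mathcal U}U_k$, $\prod_k^{\mathcal V}U_k$ are the corresponding metric ultraproducts, then $\varphi^{\prod_k^{\mathcal U}U_k}=\varphi^{\prod_k^{\mathcal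 V}U_k}$ for every such sentence $\varphi$. -/

import Mathlib

open Filter Topology

/-- A bi-invariant metric group of diameter at most `1`. -/
class BiInvMetricGroup (G : Type*) extends Group G, MetricSpace G where
  dist_le_one' : ∀ a b : G, dist a b ≤ 1
  dist_mul_left' : ∀ c a b : G, dist (c * a) (c * b) = dist a b
  dist_mul_right' : ∀ c a b : G, dist (a * c) (b * c) = dist a b

/-! ### Continuous logic in the language of bi-invariant metric groups

The language has the function symbols of groups (identity, multiplication, inverse) and no
relation symbol apart from the metric.  Formulas take values in `[0, 1]`. -/

/-- Group terms in the variables `x_i`, `i : Fin m`. -/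
inductive GroupTerm (m : ℕ) : Type
  | var (i : Fin m) : GroupTerm m
  | one : GroupTerm m
  | mul (s t : GroupTerm m) : GroupTerm m
  | inv (s : GroupTerm m) : GroupTerm m

/-- The interpretation of a term in a group. -/
def GroupTerm.eval {m : ℕ} {G : Type*} [Group G] (v : Fin m → G) : GroupTerm m → G
  | .var i => v i
  | .one => 1
  | .mul s t => s.eval v * t.eval v
  | .inv s => (s.eval v)⁻¹

/-- Formulas of continuous logic in the language of bi-invariant metric groups, with free
variables `x_i`, `i : Fin m`.  Connectives are all continuous functions `[0, 1]^k → [0, 1]`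
(`k = 0` gives the constants); the quantifiers bind the last variable. -/
inductive MetricFormula : ℕ → Type
  | dist {m : ℕ} (s t : GroupTerm m) : MetricFormula m
  | conn {m k : ℕ} (u : C(Fin k → unitInterval, unitInterval))
      (φ : Fin k → MetricFormula m) : MetricFormula m
  | inf {m : ℕ} (φ : MetricFormula (m + 1)) : MetricFormula m
  | sup {m : ℕ} (φ : MetricFormula (m + 1)) : MetricFormula m

namespace MetricFormula

/-- The value `φ^G(v)` of a formula in a bi-invariant metric group. -/
noncomputable def eval (G : Type*) [BiInvMetricGroup G] :
    {m : ℕ} → MetricFormula m → (Fin m → G) → unitInterval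
  | _, .dist s t, v =>
      ⟨Dist.dist (s.eval v) (t.eval v), dist_nonneg, BiInvMetricGroup.dist_le_one' _ _⟩
  | _, .conn u φ, v => u fun i => (φ i).eval G v
  | _, .inf φ, v => ⨅ a : G, φ.eval G (Fin.snoc v a)
  | _, .sup φ, v => ⨆ a : G, φ.eval G (Fin.snoc v a)

/-- The value `φ^G` of a sentence. -/
noncomputable def value (φ : MetricFormula 0) (G : Type*) [BiInvMetricGroup G] : unitInterval :=
  φ.eval G Fin.elim0

/-- Formulas without quantifiers. -/
inductive IsQuantifierFree : {m : ℕ} → MetricFormula m → Prop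
  | dist {m : ℕ} (s t : GroupTerm m) : IsQuantifierFree (.dist s t)
  | conn {m k : ℕ} (u : C(Fin k → unitInterval, unitInterval)) (φ : Fin k → MetricFormula m)
      (h : ∀ i, IsQuantifierFree (φ i)) : IsQuantifierFree (.conn u φ)

/-- `sup_{y_1, …, y_n} φ`, where `y_1, …, y_n` are the last `n` variables. -/
def sups {m : ℕ} : (n : ℕ) → MetricFormula (m + n) → MetricFormula m
  | 0, φ => φ
  | n + 1, φ => sups n (sup φ)

/-- Sentences `inf_x sup_{y_1, …, y_n} ψ(x, y_1, …, y_n)` with `ψ` quantifier-free. -/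
def IsSigmaTwo (φ : MetricFormula 0) : Prop :=
  ∃ (n : ℕ) (ψ : MetricFormula (1 + n)), ψ.IsQuantifierFree ∧ φ = inf (sups n ψ)

end MetricFormula

/-- Two bi-invariant metric groups have the same metric `Σ₂`-theory. -/
def SameSigmaTwoTheory (G H : Type*) [BiInvMetricGroup G] [BiInvMetricGroup H] : Prop :=
  ∀ φ : MetricFormula 0, φ.IsSigmaTwo → φ.value G = φ.value H

/-! ### The unitary groups with the normalized Hilbert–Schmidt metric -/

/-- The Hilbert–Schmidt norm `‖A‖₂ = (∑ |A_ij|²)^{1/2}`. -/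
noncomputable def hsNorm {n : ℕ} (A : Matrix (Fin n) (Fin n) ℂ) : ℝ :=
  √(∑ i, ∑ j, ‖A i j‖ ^ 2)

section hsNorm
attribute [local instance] Matrix.frobeniusNormedAddCommGroup

theorem hsNorm_eq_norm {n : ℕ} (A : Matrix (Fin n) (Fin n) ℂ) : hsNorm A = ‖A‖ := by
  rw [Matrix.frobenius_norm_def, hsNorm, Real.sqrt_eq_rpow]
  norm_cast

theorem hsNorm_triangle {n : ℕ} (A B C : Matrix (Fin n) (Fin n) ℂ) :
    hsNorm (A - C) ≤ hsNorm (A - B) + hsNorm (B - C) := by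
  simpa only [hsNorm_eq_norm] using norm_sub_le_norm_sub_add_norm_sub A B C

theorem hsNorm_sub_le {n : ℕ} (A B : Matrix (Fin n) (Fin n) ℂ) :
    hsNorm (A - B) ≤ hsNorm A + hsNorm B := by
  simpa only [hsNorm_eq_norm] using norm_sub_le A B

theorem hsNorm_sub_comm {n : ℕ} (A B : Matrix (Fin n) (Fin n) ℂ) :
    hsNorm (A - B) = hsNorm (B - A) := by
  simpa only [hsNorm_eq_norm] using norm_sub_rev A B

theorem hsNorm_eq_zero {n : ℕ} {A : Matrix (Fin n) (Fin n) ℂ} : hsNorm A = 0 ↔ A = 0 := by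
  simp only [hsNorm_eq_norm, norm_eq_zero]

theorem hsNorm_conjTranspose {n : ℕ} (A : Matrix (Fin n) (Fin n) ℂ) :
    hsNorm A.conjTranspose = hsNorm A := by
  simpa only [hsNorm_eq_norm] using Matrix.frobenius_norm_conjTranspose A

end hsNorm

theorem hsNorm_eq_trace {n : ℕ} (A : Matrix (Fin n) (Fin n) ℂ) :
    hsNorm A = √(Matrix.trace (A.conjTranspose * A)).re := by
  have h : (Matrix.trace (A.conjTranspose * A)).re = ∑ i, ∑ j, ‖A i j‖ ^ 2 := by
    rw [Finset.sum_comm]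
    simp only [Matrix.trace, Matrix.diag, Matrix.mul_apply, Matrix.conjTranspose_apply,
      Complex.re_sum]
    refine Finset.sum_congr rfl fun i _ => Finset.sum_congr rfl fun j _ => ?_
    rw [← Complex.normSq_eq_norm_sq, Complex.star_def, ← Complex.normSq_eq_conj_mul_self,
      Complex.ofReal_re]
  rw [h, hsNorm]

theorem hsNorm_unitary_mul {n : ℕ} (U : Matrix.unitaryGroup (Fin n) ℂ)
    (A : Matrix (Fin n) (Fin n) ℂ) : hsNorm ((U : Matrix (Fin n) (Fin n) ℂ) * A) = hsNorm A := by
  have h : (U : Matrix (Fin n) (Fin n) ℂ).conjTranspose * U = 1 :=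
    Matrix.mem_unitaryGroup_iff'.mp U.2
  rw [hsNorm_eq_trace, hsNorm_eq_trace, Matrix.conjTranspose_mul, Matrix.mul_assoc,
    ← Matrix.mul_assoc _ (U : Matrix (Fin n) (Fin n) ℂ) A, h, Matrix.one_mul]

theorem hsNorm_mul_unitary {n : ℕ} (U : Matrix.unitaryGroup (Fin n) ℂ)
    (A : Matrix (Fin n) (Fin n) ℂ) : hsNorm (A * (U : Matrix (Fin n) (Fin n) ℂ)) = hsNorm A := by
  rw [← hsNorm_conjTranspose, Matrix.conjTranspose_mul]
  exact (hsNorm_unitary_mul U⁻¹ _).trans (hsNorm_conjTranspose A)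

theorem hsNorm_unitary {n : ℕ} (U : Matrix.unitaryGroup (Fin n) ℂ) :
    hsNorm (U : Matrix (Fin n) (Fin n) ℂ) = √n := by
  have h : (U : Matrix (Fin n) (Fin n) ℂ).conjTranspose * U = 1 :=
    Matrix.mem_unitaryGroup_iff'.mp U.2
  rw [hsNorm_eq_trace, h]
  simp

/-- The unitary group `U_n` of `n × n` complex matrices; a type of its own, since it carries the
metric below. -/
def UnitaryMetricGroup (n : ℕ+) : Type := Matrix.unitaryGroup (Fin n) ℂ

namespace UnitaryMetricGroup

noncomputable instance (n : ℕ+) : Group (UnitaryMetricGroup n) :=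
  inferInstanceAs (Group (Matrix.unitaryGroup (Fin n) ℂ))

/-- The matrix underlying an element of `U_n`. -/
def toMatrix {n : ℕ+} (A : UnitaryMetricGroup n) : Matrix (Fin n) (Fin n) ℂ :=
  Subtype.val (p := (· ∈ Matrix.unitaryGroup (Fin n) ℂ)) A

/-- `d(A, B) = ‖A - B‖₂ / (2 √n)`. -/
noncomputable instance (n : ℕ+) : MetricSpace (UnitaryMetricGroup n) where
  dist A B := hsNorm (A.toMatrix - B.toMatrix) / (2 * √(n : ℕ))
  dist_self A := by simp [hsNorm_eq_zero.mpr]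
  dist_comm A B := by rw [hsNorm_sub_comm]
  dist_triangle A B C := by
    rw [← add_div]
    gcongr
    exact hsNorm_triangle _ _ _
  eq_of_dist_eq_zero {A B} h := by
    have hn : (2 * √(n : ℕ) : ℝ) ≠ 0 := by
      have : (0 : ℝ) < (n : ℕ) := by exact_mod_cast n.pos
      positivity
    have h' := hsNorm_eq_zero.mp ((div_eq_zero_iff.mp h).resolve_right hn)
    exact Subtype.ext (sub_eq_zero.mp h')

theorem dist_def {n : ℕ+} (A B : UnitaryMetricGroup n) :
    dist A B = hsNorm (A.toMatrix - B.toMatrix) / (2 * √(n : ℕ)) := rfl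

theorem toMatrix_mul {n : ℕ+} (A B : UnitaryMetricGroup n) :
    (A * B).toMatrix = A.toMatrix * B.toMatrix := rfl

noncomputable instance (n : ℕ+) : BiInvMetricGroup (UnitaryMetricGroup n) where
  dist_le_one' A B := by
    have hn : (0 : ℝ) < (n : ℕ) := by exact_mod_cast n.pos
    rw [dist_def, div_le_one (by positivity)]
    refine (hsNorm_sub_le _ _).trans_eq ?_
    refine (congrArg₂ (· + ·) (hsNorm_unitary A) (hsNorm_unitary B)).trans ?_
    ring
  dist_mul_left' C A B := by
    rw [dist_def, dist_def, toMatrix_mul, toMatrix_mul, ← Matrix.mul_sub]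
    exact congrArg (· / _) (hsNorm_unitary_mul _ _)
  dist_mul_right' C A B := by
    rw [dist_def, dist_def, toMatrix_mul, toMatrix_mul, ← Matrix.sub_mul]
    exact congrArg (· / _) (hsNorm_mul_unitary _ _)

end UnitaryMetricGroup

/-! ### Metric ultraproducts -/

/-- The full product `∏_i G_i`, to be equipped with the pseudometric
`d(x, y) = lim_{i → 𝒰} d(x_i, y_i)`. -/
def PreUltraproduct {ι : Type*} (_ : Ultrafilter ι) (G : ι → Type*) : Type _ := ∀ i, G i

namespace PreUltraproduct

variable {ι : Type*} (𝒰 : Ultrafilter ι) (G : ι → Type*) [∀ i, BiInvMetricGroup (G i)]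

instance : Group (PreUltraproduct 𝒰 G) := inferInstanceAs (Group (∀ i, G i))

noncomputable instance : Dist (PreUltraproduct 𝒰 G) where
  dist x y := limUnder (𝒰 : Filter ι) fun i => dist (x i) (y i)

theorem tendsto_dist (x y : PreUltraproduct 𝒰 G) :
    Tendsto (fun i => dist (x i) (y i)) 𝒰 (𝓝 (dist x y)) := by
  refine tendsto_nhds_limUnder ?_
  have hK : IsCompact (Set.Icc (0 : ℝ) 1) := isCompact_Icc
  have hmem : Set.Icc (0 : ℝ) 1 ∈ 𝒰.map fun i => dist (x i) (y i) :=
    Ultrafilter.mem_map.mpr (univ_mem' fun i =>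
      ⟨dist_nonneg, BiInvMetricGroup.dist_le_one' _ _⟩)
  obtain ⟨r, -, hr⟩ := hK.ultrafilter_le_nhds _ (le_principal_iff.mpr hmem)
  exact ⟨r, hr⟩

noncomputable instance : PseudoMetricSpace (PreUltraproduct 𝒰 G) where
  dist_self x := tendsto_nhds_unique (tendsto_dist 𝒰 G x x) (by simp)
  dist_comm x y := tendsto_nhds_unique (tendsto_dist 𝒰 G x y)
    (by simpa only [dist_comm] using tendsto_dist 𝒰 G y x)
  dist_triangle x y z := le_of_tendsto_of_tendsto' (tendsto_dist 𝒰 G x z)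
    ((tendsto_dist 𝒰 G x y).add (tendsto_dist 𝒰 G y z)) fun i => dist_triangle _ _ _

theorem dist_le_one (x y : PreUltraproduct 𝒰 G) : dist x y ≤ 1 :=
  le_of_tendsto' (tendsto_dist 𝒰 G x y) fun _ => BiInvMetricGroup.dist_le_one' _ _

theorem dist_mul_left (z x y : PreUltraproduct 𝒰 G) : dist (z * x) (z * y) = dist x y :=
  tendsto_nhds_unique (tendsto_dist 𝒰 G (z * x) (z * y))
    ((tendsto_dist 𝒰 G x y).congr fun i => (BiInvMetricGroup.dist_mul_left' (z i) _ _).symm)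

theorem dist_mul_right (z x y : PreUltraproduct 𝒰 G) : dist (x * z) (y * z) = dist x y :=
  tendsto_nhds_unique (tendsto_dist 𝒰 G (x * z) (y * z))
    ((tendsto_dist 𝒰 G x y).congr fun i => (BiInvMetricGroup.dist_mul_right' (z i) _ _).symm)

theorem dist_inv (x y : PreUltraproduct 𝒰 G) : dist x⁻¹ y⁻¹ = dist x y := by
  rw [← dist_mul_left 𝒰 G x, ← dist_mul_right 𝒰 G y, mul_inv_cancel, one_mul,
    inv_mul_cancel_right, dist_comm]

instance : IsTopologicalGroup (PreUltraproduct 𝒰 G) where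
  continuous_mul := by
    refine continuous_iff_continuousAt.mpr fun p => ?_
    rw [ContinuousAt, tendsto_iff_dist_tendsto_zero]
    have h1 : Tendsto (fun q : PreUltraproduct 𝒰 G × PreUltraproduct 𝒰 G =>
        dist q.1 p.1 + dist q.2 p.2) (𝓝 p) (𝓝 0) := by
      have : Continuous fun q : PreUltraproduct 𝒰 G × PreUltraproduct 𝒰 G =>
        dist q.1 p.1 + dist q.2 p.2 := by fun_prop
      simpa using this.tendsto p
    refine squeeze_zero (fun _ => dist_nonneg) (fun q => ?_) h1
    refine (dist_triangle _ (p.1 * q.2) _).trans_eq ?_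
    rw [dist_mul_right, dist_mul_left]
  continuous_inv := (Isometry.of_dist_eq (dist_inv 𝒰 G)).continuous

end PreUltraproduct

/-- The metric ultraproduct of the groups `G_i` along `𝒰`: the product modulo the elements at
distance zero, with the group structure and the metric induced on the quotient. -/
def MetricUltraproduct {ι : Type*} (𝒰 : Ultrafilter ι) (G : ι → Type*)
    [∀ i, BiInvMetricGroup (G i)] : Type _ :=
  SeparationQuotient (PreUltraproduct 𝒰 G)

noncomputable instance {ι : Type*} (𝒰 : Ultrafilter ι) (G : ι → Type*)
    [∀ i, BiInvMetricGroup (G i)] : Group (MetricUltraproduct 𝒰 G) :=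
  inferInstanceAs (Group (SeparationQuotient (PreUltraproduct 𝒰 G)))

noncomputable instance {ι : Type*} (𝒰 : Ultrafilter ι) (G : ι → Type*)
    [∀ i, BiInvMetricGroup (G i)] : MetricSpace (MetricUltraproduct 𝒰 G) :=
  inferInstanceAs (MetricSpace (SeparationQuotient (PreUltraproduct 𝒰 G)))

noncomputable instance {ι : Type*} (𝒰 : Ultrafilter ι) (G : ι → Type*)
    [∀ i, BiInvMetricGroup (G i)] : BiInvMetricGroup (MetricUltraproduct 𝒰 G) where
  dist_le_one' := by
    refine Quotient.ind₂ fun a b => ?_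
    exact PreUltraproduct.dist_le_one 𝒰 G a b
  dist_mul_left' := by
    refine Quotient.ind fun c => Quotient.ind₂ fun a b => ?_
    exact PreUltraproduct.dist_mul_left 𝒰 G c a b
  dist_mul_right' := by
    refine Quotient.ind fun c => Quotient.ind₂ fun a b => ?_
    exact PreUltraproduct.dist_mul_right 𝒰 G c a b

/-- The universal hyperlinear group `∏_𝒰 U_n` given by an ultrafilter `𝒰` on `{1, 2, 3, …}`. -/
abbrev UniversalHyperlinearGroup (𝒰 : Ultrafilter ℕ+) : Type :=
  MetricUltraproduct 𝒰 UnitaryMetricGroup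

/-! ### Formulas under perturbations, homomorphisms and ultraproducts -/

/-! The values of a `Σ₂` sentence in the groups `U_k` are almost increasing: for every `ε > 0`, if
`k` is large and `N` is large depending on `k`, then the value in `U_k` is at most the value in
`U_N` plus `ε` (`eventually_value_le`). A bounded sequence with this property converges.

Universal formulas almost do not decrease along an almost isometric homomorphism `h : U_k → U_N`,
because the suprema over `U_N` see the whole image of `h`. It therefore suffices that any given `x`
in `U_N` lies close to `h y` for some such `h`, which may depend on `x`, and some `y` in `U_k`;
uniform continuity of formulas absorbs the distance. This is where a single outer variable matters:
one unitary can be diagonalized. Sort its eigenvalue angles, cut them into `k` blocks of equal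
length `m`, make the angle constant on each block and replace the `r < k` leftover eigenvalues by
`1`. Up to conjugation the result is `y ⊗ 1_m ⊕ 1_r`, and it is near `x` when `k` and `N / k` are
large (`exists_monoidHom_dist_sq_le`).

Łoś's theorem identifies the value in an ultraproduct with the limit along the ultrafilter, hence
with the ordinary limit when the ultrafilter is nonprincipal. -/

namespace unitInterval

/-- The real bound `c` may exceed `1`, so it is truncated before it is compared in `[0, 1]`.
Nonnegativity covers an empty index type, whose supremum is `0`. -/
theorem coe_iSup_le {ι : Type*} {f : ι → unitInterval} {c : ℝ} (hc : 0 ≤ c)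
    (h : ∀ i, (f i : ℝ) ≤ c) : ((⨆ i, f i : unitInterval) : ℝ) ≤ c := by
  have : (⨆ i, f i) ≤ (⟨min c 1, le_min hc zero_le_one, min_le_right _ _⟩ : unitInterval) :=
    iSup_le fun i => Subtype.coe_le_coe.mp (le_min (h i) (f i).2.2)
  exact (Subtype.coe_le_coe.mpr this).trans (min_le_left _ _)

theorem le_coe_iInf {ι : Type*} {f : ι → unitInterval} {c : ℝ} (hc : c ≤ 1)
    (h : ∀ i, c ≤ (f i : ℝ)) : c ≤ ((⨅ i, f i : unitInterval) : ℝ) := by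
  have : (⟨max c 0, le_max_right _ _, max_le hc zero_le_one⟩ : unitInterval) ≤ ⨅ i, f i :=
    le_iInf fun i => Subtype.coe_le_coe.mp (max_le (h i) (f i).2.1)
  exact (le_max_left _ _).trans (Subtype.coe_le_coe.mpr this)

theorem coe_le_coe_iSup {ι : Type*} (f : ι → unitInterval) (i : ι) :
    (f i : ℝ) ≤ ((⨆ i, f i : unitInterval) : ℝ) :=
  Subtype.coe_le_coe.mpr (le_iSup f i)

theorem coe_iInf_le_coe {ι : Type*} (f : ι → unitInterval) (i : ι) :
    ((⨅ i, f i : unitInterval) : ℝ) ≤ (f i : ℝ) :=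
  Subtype.coe_le_coe.mpr (iInf_le f i)

theorem coe_iSup_le_add {ι κ : Type*} {f : ι → unitInterval} {g : κ → unitInterval} {ε : ℝ}
    (hε : 0 ≤ ε) (h : ∀ i, ∃ j, (f i : ℝ) ≤ g j + ε) :
    ((⨆ i, f i : unitInterval) : ℝ) ≤ (⨆ j, g j : unitInterval) + ε := by
  refine coe_iSup_le (add_nonneg (unitInterval.nonneg _) hε) fun i => ?_
  obtain ⟨j, hj⟩ := h i
  exact hj.trans (by gcongr; exact coe_le_coe_iSup g j)

theorem coe_iInf_le_add {ι κ : Type*} {f : ι → unitInterval} {g : κ → unitInterval} {ε : ℝ}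
    (hε : 0 ≤ ε) (h : ∀ j, ∃ i, (f i : ℝ) ≤ g j + ε) :
    ((⨅ i, f i : unitInterval) : ℝ) ≤ (⨅ j, g j : unitInterval) + ε := by
  rw [← sub_le_iff_le_add]
  refine le_coe_iInf ((sub_le_self _ hε).trans (unitInterval.le_one _)) fun j => ?_
  obtain ⟨i, hi⟩ := h j
  rw [sub_le_iff_le_add]
  exact (coe_iInf_le_coe f i).trans hi

theorem dist_le_of_le_add {a b : unitInterval} {ε : ℝ} (h₁ : (a : ℝ) ≤ b + ε)
    (h₂ : (b : ℝ) ≤ a + ε) : dist a b ≤ ε := by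
  rw [Subtype.dist_eq, Real.dist_eq, abs_le]
  constructor <;> linarith

theorem le_add_of_dist_le {a b : unitInterval} {ε : ℝ} (h : dist a b ≤ ε) :
    (a : ℝ) ≤ b + ε := by
  rw [Subtype.dist_eq, Real.dist_eq, abs_le] at h
  linarith

end unitInterval

/-! ### Uniform continuity of terms and formulas, and their behaviour under almost isometric
homomorphisms. -/

theorem BiInvMetricGroup.dist_inv_inv {G : Type*} [BiInvMetricGroup G] (a b : G) :
    dist a⁻¹ b⁻¹ = dist a b := by
  rw [← BiInvMetricGroup.dist_mul_left' a, ← BiInvMetricGroup.dist_mul_right' b, mul_inv_cancel,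
    one_mul, inv_mul_cancel_right, dist_comm]

theorem BiInvMetricGroup.dist_mul_mul_le {G : Type*} [BiInvMetricGroup G] (a b c d : G) :
    dist (a * b) (c * d) ≤ dist a c + dist b d := by
  refine (dist_triangle _ (c * b) _).trans_eq ?_
  rw [BiInvMetricGroup.dist_mul_right', BiInvMetricGroup.dist_mul_left']

namespace GroupTerm

/-- By bi-invariance the errors add under multiplication and are unchanged by inversion, so `C`
counts the occurrences of variables in `t` and does not depend on the group. -/
theorem exists_dist_eval_le {m : ℕ} (t : GroupTerm m) :
    ∃ C : ℝ, ∀ (δ : ℝ), 0 ≤ δ → ∀ (G : Type) [BiInvMetricGroup G] (v w : Fin m → G),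
      (∀ i, dist (v i) (w i) ≤ δ) → dist (t.eval v) (t.eval w) ≤ C * δ := by
  induction t with
  | var i => exact ⟨1, fun δ _ G _ v w h => by simpa [eval] using h i⟩
  | one => exact ⟨0, fun δ _ G _ v w _ => by simp [eval]⟩
  | mul s t hs ht =>
    obtain ⟨C, hC⟩ := hs
    obtain ⟨D, hD⟩ := ht
    refine ⟨C + D, fun δ hδ G _ v w h => ?_⟩
    rw [add_mul]
    exact (BiInvMetricGroup.dist_mul_mul_le _ _ _ _).trans
      (add_le_add (hC δ hδ G v w h) (hD δ hδ G v w h))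
  | inv s hs =>
    obtain ⟨C, hC⟩ := hs
    exact ⟨C, fun δ hδ G _ v w h =>
      (BiInvMetricGroup.dist_inv_inv _ _).trans_le (hC δ hδ G v w h)⟩

theorem eval_map {m : ℕ} {G H : Type*} [Group G] [Group H] (h : G →* H) (v : Fin m → G)
    (t : GroupTerm m) : t.eval (h ∘ v) = h (t.eval v) := by
  induction t with
  | var i => rfl
  | one => exact (map_one h).symm
  | mul s t hs ht => simp only [eval, hs, ht, map_mul]
  | inv s hs => simp only [eval, hs, map_inv]

end GroupTerm

namespace MetricFormula

theorem exists_dist_conn_le {k : ℕ} (u : C(Fin k → unitInterval, unitInterval)) {ε : ℝ}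
    (hε : 0 < ε) : ∃ η > 0, ∀ a b : Fin k → unitInterval,
      (∀ i, Dist.dist (a i) (b i) ≤ η) → Dist.dist (u a) (u b) ≤ ε := by
  have hu := CompactSpace.uniformContinuous_of_continuous u.continuous
  obtain ⟨η, hη, h⟩ := Metric.uniformContinuous_iff.mp hu ε hε
  refine ⟨η / 2, half_pos hη, fun a b hab => (h ?_).le⟩
  exact ((dist_pi_le_iff (half_pos hη).le).mpr hab).trans_lt (half_lt_self hη)

/-- Formulas are uniformly continuous, uniformly in the bi-invariant metric group. -/
theorem eventually_dist_eval_le {m : ℕ} (φ : MetricFormula m) {ε : ℝ} (hε : 0 < ε) :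
    ∀ᶠ δ in 𝓝[>] (0 : ℝ), ∀ (G : Type) [BiInvMetricGroup G] (v w : Fin m → G),
      (∀ i, Dist.dist (v i) (w i) ≤ δ) → Dist.dist (φ.eval G v) (φ.eval G w) ≤ ε := by
  induction φ generalizing ε with
  | dist s t =>
    obtain ⟨C, hC⟩ := s.exists_dist_eval_le
    obtain ⟨D, hD⟩ := t.exists_dist_eval_le
    have hlim : Tendsto (fun δ : ℝ => C * δ + D * δ) (𝓝[>] 0) (𝓝 0) := by
      have : Continuous fun δ : ℝ => C * δ + D * δ := by fun_prop
      simpa using (this.tendsto 0).mono_left nhdsWithin_le_nhds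
    filter_upwards [hlim.eventually_lt_const hε, self_mem_nhdsWithin] with δ hδ hδ0 G _ v w h
    have hδ0 : (0 : ℝ) < δ := hδ0
    exact (dist_dist_dist_le _ _ _ _).trans
      ((add_le_add (hC δ hδ0.le G v w h) (hD δ hδ0.le G v w h)).trans hδ.le)
  | conn u φ ih =>
    obtain ⟨η, hη, hu⟩ := exists_dist_conn_le u hε
    filter_upwards [eventually_all.mpr fun i => ih i hη] with δ hδ G _ v w h
    exact hu _ _ fun i => hδ i G v w h
  | inf φ ih =>
    filter_upwards [ih hε, self_mem_nhdsWithin] with δ hδ hδ0 G _ v w h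
    have key : ∀ a : G, Dist.dist (φ.eval G (Fin.snoc v a)) (φ.eval G (Fin.snoc w a)) ≤ ε := by
      refine fun a => hδ G _ _ fun i => ?_
      refine Fin.lastCases ?_ (fun j => ?_) i
      · simpa using le_of_lt hδ0
      · simpa using h j
    exact unitInterval.dist_le_of_le_add
      (unitInterval.coe_iInf_le_add hε.le fun a => ⟨a, unitInterval.le_add_of_dist_le (key a)⟩)
      (unitInterval.coe_iInf_le_add hε.le fun a =>
        ⟨a, unitInterval.le_add_of_dist_le (dist_comm (φ.eval G _) _ ▸ key a)⟩)
  | sup φ ih =>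
    filter_upwards [ih hε, self_mem_nhdsWithin] with δ hδ hδ0 G _ v w h
    have key : ∀ a : G, Dist.dist (φ.eval G (Fin.snoc v a)) (φ.eval G (Fin.snoc w a)) ≤ ε := by
      refine fun a => hδ G _ _ fun i => ?_
      refine Fin.lastCases ?_ (fun j => ?_) i
      · simpa using le_of_lt hδ0
      · simpa using h j
    exact unitInterval.dist_le_of_le_add
      (unitInterval.coe_iSup_le_add hε.le fun a => ⟨a, unitInterval.le_add_of_dist_le (key a)⟩)
      (unitInterval.coe_iSup_le_add hε.le fun a =>
        ⟨a, unitInterval.le_add_of_dist_le (dist_comm (φ.eval G _) _ ▸ key a)⟩)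

/-- Almost isometric homomorphisms almost preserve quantifier-free formulas. -/
theorem IsQuantifierFree.eventually_dist_eval_map_le {m : ℕ} {φ : MetricFormula m}
    (hφ : φ.IsQuantifierFree) {ε : ℝ} (hε : 0 < ε) :
    ∀ᶠ δ in 𝓝[>] (0 : ℝ), ∀ (G H : Type) [BiInvMetricGroup G] [BiInvMetricGroup H] (h : G →* H),
      (∀ a b, |Dist.dist (h a) (h b) - Dist.dist a b| ≤ δ) → ∀ v : Fin m → G,
      Dist.dist (φ.eval G v) (φ.eval H (h ∘ v)) ≤ ε := by
  induction hφ generalizing ε with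
  | dist s t =>
    filter_upwards [(eventually_lt_nhds hε).filter_mono nhdsWithin_le_nhds] with δ hδ G H _ _ h hh v
    rw [Subtype.dist_eq, Real.dist_eq, abs_sub_comm]
    simpa only [eval, GroupTerm.eval_map] using (hh _ _).trans hδ.le
  | conn u φ _ ih =>
    obtain ⟨η, hη, hu⟩ := exists_dist_conn_le u hε
    filter_upwards [eventually_all.mpr fun i => ih i hη] with δ hδ G H _ _ h hh v
    exact hu _ _ fun i => hδ i G H h hh v

/-- Almost isometric homomorphisms almost do not decrease universal formulas. -/
theorem IsQuantifierFree.eventually_eval_sups_le {m n : ℕ} {φ : MetricFormula (m + n)}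
    (hφ : φ.IsQuantifierFree) {ε : ℝ} (hε : 0 < ε) :
    ∀ᶠ δ in 𝓝[>] (0 : ℝ), ∀ (G H : Type) [BiInvMetricGroup G] [BiInvMetricGroup H] (h : G →* H),
      (∀ a b, |Dist.dist (h a) (h b) - Dist.dist a b| ≤ δ) → ∀ v : Fin m → G,
      ((sups n φ).eval G v : ℝ) ≤ (sups n φ).eval H (h ∘ v) + ε := by
  filter_upwards [hφ.eventually_dist_eval_map_le hε] with δ hδ G H _ _ h hh
  replace hδ := fun v => unitInterval.le_add_of_dist_le (hδ G H h hh v)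
  -- The induction adds quantifiers to the formula, and `sup φ` is no longer quantifier-free; only
  -- the inequality `hδ` is carried along.
  clear hφ
  induction n with
  | zero => exact hδ
  | succ n ih =>
    -- Values at `a` are compared with values at `h a`. The supremum over `H` also ranges outside
    -- the image, so only one inequality survives.
    refine ih fun v => unitInterval.coe_iSup_le_add hε.le fun a => ⟨h a, ?_⟩
    rw [← Fin.comp_snoc]
    exact hδ _

/-! ### Values of formulas in metric ultraproducts. -/

variable {ι : Type*} (𝒰 : Ultrafilter ι) (G : ι → Type*) [∀ i, BiInvMetricGroup (G i)]

/-- The class of a family in the metric ultraproduct. -/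
noncomputable def _root_.MetricUltraproduct.mk : PreUltraproduct 𝒰 G →* MetricUltraproduct 𝒰 G :=
  SeparationQuotient.mkMonoidHom

theorem _root_.MetricUltraproduct.mk_surjective :
    Function.Surjective (MetricUltraproduct.mk 𝒰 G) :=
  SeparationQuotient.surjective_mk

theorem _root_.MetricUltraproduct.dist_mk (x y : PreUltraproduct 𝒰 G) :
    Dist.dist (MetricUltraproduct.mk 𝒰 G x) (MetricUltraproduct.mk 𝒰 G y) = Dist.dist x y :=
  SeparationQuotient.dist_mk x y

/-- Łoś's theorem for metric ultraproducts. -/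
theorem tendsto_eval_ultraproduct {m : ℕ} (φ : MetricFormula m)
    (v : Fin m → PreUltraproduct 𝒰 G) :
    Tendsto (fun i => φ.eval (G i) fun j => v j i) 𝒰
      (𝓝 (φ.eval (MetricUltraproduct 𝒰 G) (MetricUltraproduct.mk 𝒰 G ∘ v))) := by
  induction φ with
  | dist s t =>
    refine tendsto_subtype_rng.mpr ?_
    have key : ∀ (t : GroupTerm _) (i : ι), t.eval (fun j => v j i) = t.eval v i := fun t i =>
      t.eval_map (Pi.evalMonoidHom G i) v
    simp only [eval, key, GroupTerm.eval_map, MetricUltraproduct.dist_mk]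
    exact PreUltraproduct.tendsto_dist 𝒰 G _ _
  | conn u φ ih => exact (u.continuous.tendsto _).comp (tendsto_pi_nhds.mpr fun i => ih i v)
  | inf φ ih =>
    have hs : ∀ (a : PreUltraproduct 𝒰 G) (i : ι),
        (fun j => (Fin.snoc v a : Fin _ → PreUltraproduct 𝒰 G) j i) =
          Fin.snoc (fun j => v j i) (a i) := fun a i =>
      Fin.comp_snoc (fun x : PreUltraproduct 𝒰 G => x i) v a
    have ih' : ∀ a, Tendsto (fun i => φ.eval (G i) (Fin.snoc (fun j => v j i) (a i))) 𝒰
        (𝓝 (φ.eval _ (Fin.snoc (MetricUltraproduct.mk 𝒰 G ∘ v) (MetricUltraproduct.mk 𝒰 G a)))) := by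
      intro a
      have := ih (Fin.snoc v a)
      rwa [Fin.comp_snoc, funext fun i => congrArg _ (hs a i)] at this
    refine tendsto_order.mpr ⟨fun c hc => ?_, fun c hc => ?_⟩
    · by_contra hcon
      rw [← Ultrafilter.eventually_not] at hcon
      obtain ⟨c', hc', hc''⟩ := exists_between hc
      -- The infimum need not be attained and strict inequalities weaken in the limit; `c'` leaves
      -- room for both. The near-minimizers `a i` form one element of the ultraproduct, whose value
      -- is at most `c'`.
      have : ∀ i, ∃ a : G i, (inf φ).eval (G i) (fun j => v j i) ≤ c →
          φ.eval (G i) (Fin.snoc (fun j => v j i) a) < c' := by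
        intro i
        by_cases h : (inf φ).eval (G i) (fun j => v j i) ≤ c
        · obtain ⟨a, ha⟩ := iInf_lt_iff.mp (h.trans_lt hc')
          exact ⟨a, fun _ => ha⟩
        -- An arbitrary value, since such indices form a `𝒰`-null set by `hcon`.
        · exact ⟨1, fun h' => absurd h' h⟩
      choose a ha using this
      have hle := le_of_tendsto (ih' a) (hcon.mono fun i hi => (ha i (not_lt.mp hi)).le)
      exact absurd (hc''.trans_le (iInf_le _ _)) (not_lt.mpr hle)
    · obtain ⟨b, hb⟩ := iInf_lt_iff.mp hc
      obtain ⟨a, rfl⟩ := MetricUltraproduct.mk_surjective 𝒰 G b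
      filter_upwards [(ih' a).eventually_lt_const hb] with i hi
      exact (iInf_le _ _).trans_lt hi
  | sup φ ih =>
    have hs : ∀ (a : PreUltraproduct 𝒰 G) (i : ι),
        (fun j => (Fin.snoc v a : Fin _ → PreUltraproduct 𝒰 G) j i) =
          Fin.snoc (fun j => v j i) (a i) := fun a i =>
      Fin.comp_snoc (fun x : PreUltraproduct 𝒰 G => x i) v a
    have ih' : ∀ a, Tendsto (fun i => φ.eval (G i) (Fin.snoc (fun j => v j i) (a i))) 𝒰
        (𝓝 (φ.eval _ (Fin.snoc (MetricUltraproduct.mk 𝒰 G ∘ v) (MetricUltraproduct.mk 𝒰 G a)))) := by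
      intro a
      have := ih (Fin.snoc v a)
      rwa [Fin.comp_snoc, funext fun i => congrArg _ (hs a i)] at this
    refine tendsto_order.mpr ⟨fun c hc => ?_, fun c hc => ?_⟩
    · obtain ⟨b, hb⟩ := lt_iSup_iff.mp hc
      obtain ⟨a, rfl⟩ := MetricUltraproduct.mk_surjective 𝒰 G b
      filter_upwards [(ih' a).eventually_const_lt hb] with i hi
      exact hi.trans_le (le_iSup (fun a => φ.eval (G i) (Fin.snoc (fun j => v j i) a)) (a i))
    · by_contra hcon
      rw [← Ultrafilter.eventually_not] at hcon
      obtain ⟨c', hc', hc''⟩ := exists_between hc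
      have : ∀ i, ∃ a : G i, c ≤ (sup φ).eval (G i) (fun j => v j i) →
          c' < φ.eval (G i) (Fin.snoc (fun j => v j i) a) := by
        intro i
        by_cases h : c ≤ (sup φ).eval (G i) (fun j => v j i)
        · obtain ⟨a, ha⟩ := lt_iSup_iff.mp (hc''.trans_le h)
          exact ⟨a, fun _ => ha⟩
        · exact ⟨1, fun h' => absurd h' h⟩
      choose a ha using this
      have hle := ge_of_tendsto (ih' a) (hcon.mono fun i hi => (ha i (not_lt.mp hi)).le)
      exact absurd ((le_iSup (fun a => φ.eval (MetricUltraproduct 𝒰 G)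
        (Fin.snoc (MetricUltraproduct.mk 𝒰 G ∘ v) a)) _).trans_lt hc') (not_lt.mpr hle)

theorem tendsto_value_ultraproduct (φ : MetricFormula 0) :
    Tendsto (fun i => φ.value (G i)) 𝒰 (𝓝 (φ.value (MetricUltraproduct 𝒰 G))) := by
  have h₁ : ∀ i, (fun j => (Fin.elim0 j : PreUltraproduct 𝒰 G) i) = Fin.elim0 := fun i =>
    funext fun j => j.elim0
  have h₂ : MetricUltraproduct.mk 𝒰 G ∘ Fin.elim0 = Fin.elim0 := funext fun j => j.elim0
  simpa only [value, h₁, h₂] using φ.tendsto_eval_ultraproduct 𝒰 G Fin.elim0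

end MetricFormula

/-! ### Diagonalization of unitaries. -/

section
open scoped Matrix.Norms.L2Operator

attribute [-instance] Matrix.SpecialLinearGroup.hasCoeToGeneralLinearGroup in
/-- Unitary matrices are unitarily diagonalizable. -/
theorem Matrix.exists_eq_mul_diagonal_mul_star {n : Type*} [Fintype n] [DecidableEq n]
    {U : Matrix n n ℂ} (hU : U ∈ Matrix.unitaryGroup n ℂ) :
    ∃ V ∈ Matrix.unitaryGroup n ℂ, ∃ d : n → ℂ, U = V * Matrix.diagonal d * star V := by
  -- The spectrum is finite, so the continuous functional calculus applies even to the discontinuous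
  -- function `arg`.
  have hcont (f : ℂ → ℂ) : ContinuousOn f (spectrum ℂ U) :=
    (Matrix.finite_spectrum U).continuousOn f
  have hnormal : IsStarNormal U := isStarNormal_of_mem_unitary hU
  have hH : (cfc (fun z : ℂ => (z.arg : ℂ)) U).IsHermitian := IsSelfAdjoint.cfc_arg U
  -- Since `|z| = 1` on the spectrum, `U = exp(i arg U)`; this reduces the claim to the spectral
  -- theorem for the Hermitian matrix `arg U`.
  have hexp : NormedSpace.exp (Complex.I • cfc (fun z : ℂ => (z.arg : ℂ)) U) = U := by
    have hc := hcont fun z : ℂ => (z.arg : ℂ)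
    rw [← cfc_smul Complex.I _ U, ← CFC.exp_eq_normedSpace_exp (𝕜 := ℂ),
      ← cfc_comp' NormedSpace.exp _ U]
    conv_rhs => rw [← cfc_id' ℂ U]
    refine cfc_congr fun z hz => ?_
    have hz₁ : ‖z‖ = 1 := spectrum.norm_eq_one_of_unitary hU hz
    have h := Complex.norm_mul_exp_arg_mul_I z
    rw [hz₁, Complex.ofReal_one, one_mul, mul_comm] at h
    simpa [← Complex.exp_eq_exp_ℂ] using h
  let V := hH.eigenvectorUnitary
  have hV : IsUnit (V : Matrix n n ℂ) := (Unitary.toUnits V).isUnit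
  have hinv : (V : Matrix n n ℂ)⁻¹ = star (V : Matrix n n ℂ) :=
    Matrix.inv_eq_right_inv (Matrix.mem_unitaryGroup_iff.mp V.2)
  refine ⟨V, V.2, NormedSpace.exp (Complex.I • (RCLike.ofReal ∘ hH.eigenvalues)), ?_⟩
  refine hexp.symm.trans ?_
  have hs := hH.spectral_theorem
  rw [Unitary.conjStarAlgAut_apply] at hs
  rw [← Matrix.exp_diagonal, ← hinv, ← Matrix.exp_conj _ _ hV, Matrix.diagonal_smul,
    Matrix.mul_smul, Matrix.smul_mul, hinv]
  exact congrArg (fun M => NormedSpace.exp (Complex.I • M)) hs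

end

/-! ### Approximating a unitary by an amplification of a smaller one -/

/-- A finite list of reals in `[a, b]` can be arranged, up to a remainder, in a `k × m` array whose
rows have total oscillation at most `b - a`. -/
theorem exists_equiv_sum_sub_le {N k m r : ℕ} (hN : k * m + r = N) {a b : ℝ} (θ : Fin N → ℝ)
    (hθ : ∀ i, θ i ∈ Set.Icc a b) (hab : a ≤ b) :
    ∃ (e : Fin N ≃ Fin k × Fin m ⊕ Fin r) (τ : Fin k → ℝ),
      (∀ j l, θ (e.symm (.inl (j, l))) - τ j ∈ Set.Icc 0 (b - a)) ∧
      ∀ l, ∑ j, (θ (e.symm (.inl (j, l))) - τ j) ≤ b - a := by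
  let σ := Tuple.sort θ
  have hσ : Monotone (θ ∘ σ) := Tuple.monotone_sort θ
  -- The sorted list, continued by the upper bound `b` so that `t (m * k)` makes sense also when `r
  -- = 0`.
  let t : ℕ → ℝ := fun i => if h : i < N then θ (σ ⟨i, h⟩) else b
  have htmem (i : ℕ) : t i ∈ Set.Icc a b := by
    by_cases h : i < N
    · simpa only [t, dif_pos h] using hθ _
    · simpa only [t, dif_neg h] using Set.right_mem_Icc.mpr hab
  have ht : Monotone t := fun i j hij => by
    by_cases hj : j < N
    · simpa only [t, dif_pos hj, dif_pos (hij.trans_lt hj), Function.comp_apply] using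
        hσ (Fin.mk_le_mk.mpr hij)
    · simpa only [t, dif_neg hj] using (htmem i).2
  let e₀ : Fin k × Fin m ⊕ Fin r ≃ Fin N :=
    ((Equiv.sumCongr finProdFinEquiv (Equiv.refl _)).trans finSumFinEquiv).trans (finCongr hN)
  have he₀ (j : Fin k) (l : Fin m) : θ (σ (e₀ (.inl (j, l)))) = t (l + m * j) := by
    have h : (e₀ (.inl (j, l)) : ℕ) = l + m * j := rfl
    have h' : (l + m * j : ℕ) < N := h ▸ (e₀ (.inl (j, l))).2
    simp only [t, dif_pos h']
    rfl
  -- Row `j` is the `j`-th block of `m` consecutive sorted values, and `τ j` is its smallest entry.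
  refine ⟨(e₀.trans σ).symm, fun j => t (m * j), fun j l => ?_, fun l => ?_⟩
  · simp only [Equiv.symm_symm, Equiv.trans_apply, he₀]
    have h := ht (Nat.le_add_left (m * j) l)
    exact ⟨sub_nonneg.mpr h, sub_le_sub (htmem _).2 (htmem _).1⟩
  · simp only [Equiv.symm_symm, Equiv.trans_apply, he₀]
    calc ∑ j : Fin k, (t (l + m * j) - t (m * j))
        ≤ ∑ j : Fin k, (t (m * (j + 1 : ℕ)) - t (m * j)) := by
          -- Each entry of a block is at most the first entry of the next one, so the sum down a
          -- column is dominated by a telescoping sum.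
          refine Finset.sum_le_sum fun j _ => sub_le_sub_right (ht ?_) _
          rw [mul_add, mul_one, add_comm]
          exact Nat.add_le_add_left l.2.le _
      _ = t (m * k) - t (m * 0) := by
          rw [Fin.sum_univ_eq_sum_range (fun j => t (m * (j + 1)) - t (m * j)),
            Finset.sum_range_sub fun j => t (m * j)]
      _ ≤ b - a := sub_le_sub (htmem _).2 (htmem _).1

theorem Complex.norm_exp_I_mul_sub_exp_I_mul_le (s t : ℝ) :
    ‖Complex.exp (Complex.I * s) - Complex.exp (Complex.I * t)‖ ≤ |s - t| := by
  have h : Complex.exp (Complex.I * s) - Complex.exp (Complex.I * t) =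
      Complex.exp (Complex.I * t) * (Complex.exp (Complex.I * (s - t : ℝ)) - 1) := by
    rw [mul_sub, ← Complex.exp_add, mul_one]
    push_cast
    ring_nf
  rw [h, norm_mul, Complex.norm_exp_I_mul_ofReal, one_mul]
  exact Real.norm_exp_I_mul_ofReal_sub_one_le

theorem hsNorm_sq {n : ℕ} (A : Matrix (Fin n) (Fin n) ℂ) : hsNorm A ^ 2 = ∑ i, ∑ j, ‖A i j‖ ^ 2 :=
  Real.sq_sqrt (by positivity)

theorem hsNorm_diagonal_sq {n : ℕ} (d : Fin n → ℂ) :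
    hsNorm (Matrix.diagonal d) ^ 2 = ∑ i, ‖d i‖ ^ 2 := by
  rw [hsNorm_sq]
  refine Finset.sum_congr rfl fun i _ => ?_
  rw [Finset.sum_eq_single i (fun j _ hj => by simp [Matrix.diagonal_apply_ne' _ hj]) (by simp),
    Matrix.diagonal_apply_eq]

/-! ### The amplification `A ↦ A ⊗ 1 ⊕ 1` of matrices. -/

section amplify
open scoped Kronecker

variable {N k m r : ℕ} (e : Fin N ≃ Fin k × Fin m ⊕ Fin r)

/-- The matrix `A ⊗ 1 ⊕ 1`, indexed through `e`. -/
def Matrix.amplify (A : Matrix (Fin k) (Fin k) ℂ) : Matrix (Fin N) (Fin N) ℂ :=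
  (Matrix.fromBlocks (A ⊗ₖ (1 : Matrix (Fin m) (Fin m) ℂ)) 0 0 1).submatrix e e

theorem Matrix.amplify_one : Matrix.amplify e 1 = 1 := by
  simp [Matrix.amplify]

theorem Matrix.amplify_mul (A B : Matrix (Fin k) (Fin k) ℂ) :
    Matrix.amplify e (A * B) = Matrix.amplify e A * Matrix.amplify e B := by
  simp [Matrix.amplify, Matrix.submatrix_mul_equiv, Matrix.fromBlocks_multiply,
    ← Matrix.mul_kronecker_mul]

theorem Matrix.star_amplify (A : Matrix (Fin k) (Fin k) ℂ) :
    star (Matrix.amplify e A) = Matrix.amplify e (star A) := by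
  simp [Matrix.amplify, Matrix.star_eq_conjTranspose, Matrix.fromBlocks_conjTranspose,
    Matrix.conjTranspose_kronecker]

theorem Matrix.amplify_diagonal (d : Fin k → ℂ) :
    Matrix.amplify e (Matrix.diagonal d) =
      Matrix.diagonal (Sum.elim (fun p => d p.1) (fun _ => 1) ∘ e) := by
  rw [Matrix.amplify, ← Matrix.diagonal_one, ← Matrix.diagonal_one,
    Matrix.diagonal_kronecker_diagonal, Matrix.fromBlocks_diagonal, Matrix.submatrix_diagonal_equiv]
  simp

/-- The two identity blocks cancel, and tensoring with `1_m` repeats each entry of `A - B` exactly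
`m` times. -/
theorem Matrix.hsNorm_amplify_sub_sq (A B : Matrix (Fin k) (Fin k) ℂ) :
    hsNorm (Matrix.amplify e A - Matrix.amplify e B) ^ 2 = m * hsNorm (A - B) ^ 2 := by
  have h : Matrix.amplify e A - Matrix.amplify e B =
      (Matrix.fromBlocks ((A - B) ⊗ₖ (1 : Matrix (Fin m) (Fin m) ℂ)) 0 0 0).submatrix e e := by
    have hsub (X Y : Matrix (Fin k × Fin m ⊕ Fin r) (Fin k × Fin m ⊕ Fin r) ℂ) :
        X.submatrix e e - Y.submatrix e e = (X - Y).submatrix e e := rfl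
    rw [Matrix.amplify, Matrix.amplify, hsub]
    congr 1
    ext (i | i) (j | j) <;> simp [Matrix.kroneckerMap_apply, sub_mul]
  rw [h, hsNorm_sq, hsNorm_sq]
  simp only [Matrix.submatrix_apply]
  rw [e.sum_comp fun i => ∑ j, ‖Matrix.fromBlocks ((A - B) ⊗ₖ (1 : Matrix (Fin m) (Fin m) ℂ)) 0 0
    (0 : Matrix (Fin r) (Fin r) ℂ) i (e j)‖ ^ 2]
  simp_rw [fun i => e.sum_comp fun j => ‖Matrix.fromBlocks ((A - B) ⊗ₖ
    (1 : Matrix (Fin m) (Fin m) ℂ)) 0 0 (0 : Matrix (Fin r) (Fin r) ℂ) i j‖ ^ 2]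
  simp [Fintype.sum_sum_type, Fintype.sum_prod_type, Matrix.kroneckerMap_apply, Matrix.one_apply,
    apply_ite, Finset.mul_sum]

end amplify

/-! ### Amplification as an almost isometric homomorphism, and approximation of a single unitary. -/

namespace UnitaryMetricGroup

/-- The unitary with the given underlying matrix. -/
def ofMatrix {n : ℕ+} (A : Matrix (Fin n) (Fin n) ℂ) (hA : A ∈ Matrix.unitaryGroup (Fin n) ℂ) :
    UnitaryMetricGroup n :=
  (⟨A, hA⟩ : Matrix.unitaryGroup (Fin n) ℂ)

theorem toMatrix_ofMatrix {n : ℕ+} (A : Matrix (Fin n) (Fin n) ℂ)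
    (hA : A ∈ Matrix.unitaryGroup (Fin n) ℂ) : (ofMatrix A hA).toMatrix = A := rfl

theorem toMatrix_injective {n : ℕ+} :
    Function.Injective (toMatrix : UnitaryMetricGroup n → Matrix (Fin n) (Fin n) ℂ) :=
  Subtype.val_injective

theorem toMatrix_mem {n : ℕ+} (A : UnitaryMetricGroup n) :
    A.toMatrix ∈ Matrix.unitaryGroup (Fin n) ℂ :=
  Subtype.prop (p := (· ∈ Matrix.unitaryGroup (Fin n) ℂ)) A

theorem dist_sq {n : ℕ+} (A B : UnitaryMetricGroup n) :
    dist A B ^ 2 = hsNorm (A.toMatrix - B.toMatrix) ^ 2 / (4 * (n : ℕ)) := by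
  rw [dist_def, div_pow, mul_pow, Real.sq_sqrt (Nat.cast_nonneg _)]
  norm_num

/-- The homomorphism `A ↦ A ⊗ 1 ⊕ 1` between unitary groups. -/
def amplify {N k : ℕ+} {m r : ℕ} (e : Fin N ≃ Fin k × Fin m ⊕ Fin r) :
    UnitaryMetricGroup k →* UnitaryMetricGroup N where
  toFun A := ofMatrix (Matrix.amplify e A.toMatrix) <| by
    rw [Matrix.mem_unitaryGroup_iff, Matrix.star_amplify, ← Matrix.amplify_mul,
      Matrix.mem_unitaryGroup_iff.mp A.toMatrix_mem, Matrix.amplify_one]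
  map_one' := toMatrix_injective (Matrix.amplify_one e)
  map_mul' A B := toMatrix_injective (Matrix.amplify_mul e A.toMatrix B.toMatrix)

theorem toMatrix_amplify {N k : ℕ+} {m r : ℕ} (e : Fin N ≃ Fin k × Fin m ⊕ Fin r)
    (A : UnitaryMetricGroup k) : (amplify e A).toMatrix = Matrix.amplify e A.toMatrix := rfl

/-- Squared distances are multiplied by `km / N = 1 - s` with `s = r / N`. As `1 - s ≤ √(1 - s) ≤ 1`
and distances are at most `1`, a distance drops by at most `s`. -/
theorem abs_dist_amplify_sub_dist_le {N k : ℕ+} {m r : ℕ} (e : Fin N ≃ Fin k × Fin m ⊕ Fin r)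
    (hN : (k : ℕ) * m + r = N) (A B : UnitaryMetricGroup k) :
    |dist (amplify e A) (amplify e B) - dist A B| ≤ r / (N : ℕ) := by
  have hN' : (k : ℝ) * m + r = (N : ℕ) := by exact_mod_cast hN
  have hN0 : (0 : ℝ) < (N : ℕ) := by exact_mod_cast N.pos
  have hk0 : (0 : ℝ) < (k : ℕ) := by exact_mod_cast k.pos
  have hr : (0 : ℝ) ≤ r / (N : ℕ) := by positivity
  have hsq : dist (amplify e A) (amplify e B) ^ 2 = (1 - r / (N : ℕ)) * dist A B ^ 2 := by
    rw [dist_sq, dist_sq, toMatrix_amplify, toMatrix_amplify, Matrix.hsNorm_amplify_sub_sq,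
      one_sub_div hN0.ne', ← hN', add_sub_cancel_right]
    rw [← hN'] at hN0
    field_simp
  have hd1 : dist A B ≤ 1 := BiInvMetricGroup.dist_le_one' _ _
  have hd0 : 0 ≤ dist A B := dist_nonneg
  have hr1 : (r : ℝ) / (N : ℕ) ≤ 1 := (div_le_one hN0).mpr (by
    rw [← hN']
    linarith [mul_nonneg hk0.le (Nat.cast_nonneg m : (0 : ℝ) ≤ m)])
  have hle : dist (amplify e A) (amplify e B) ≤ dist A B :=
    le_of_sq_le_sq (by rw [hsq]; nlinarith [sq_nonneg (dist A B)]) hd0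
  have hge : (1 - r / (N : ℕ)) * dist A B ≤ dist (amplify e A) (amplify e B) := by
    refine le_of_sq_le_sq ?_ dist_nonneg
    rw [hsq, mul_pow]
    gcongr
    nlinarith
  rw [abs_le]
  constructor <;> nlinarith

theorem exists_eq_conj_diagonal {N : ℕ+} (x : UnitaryMetricGroup N) :
    ∃ (V D : UnitaryMetricGroup N) (θ : Fin N → ℝ), (∀ i, θ i ∈ Set.Icc (-Real.pi) Real.pi) ∧
      D.toMatrix = Matrix.diagonal (fun i => Complex.exp (Complex.I * θ i)) ∧
      x = V * D * V⁻¹ := by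
  obtain ⟨V, hV, d, hd⟩ := Matrix.exists_eq_mul_diagonal_mul_star x.toMatrix_mem
  let V' := ofMatrix V hV
  have hD : (V'⁻¹ * x * V').toMatrix = Matrix.diagonal d := by
    change star V * x.toMatrix * V = _
    rw [hd, ← mul_assoc, ← mul_assoc, mul_assoc _ (star V) V, Matrix.mem_unitaryGroup_iff'.mp hV,
      one_mul, mul_one]
  have hnorm (i : Fin N) : ‖d i‖ = 1 := by
    have h := Matrix.mem_unitaryGroup_iff.mp (V'⁻¹ * x * V').toMatrix_mem
    rw [hD, Matrix.star_eq_conjTranspose, Matrix.diagonal_conjTranspose,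
      Matrix.diagonal_mul_diagonal] at h
    have h' := congrFun (congrFun h i) i
    rw [Matrix.diagonal_apply_eq, Matrix.one_apply_eq, Pi.star_apply, Complex.star_def,
      Complex.mul_conj, Complex.normSq_eq_norm_sq] at h'
    have h'' : ‖d i‖ ^ 2 = 1 := by exact_mod_cast h'
    exact (pow_eq_one_iff_of_nonneg (norm_nonneg _) two_ne_zero).mp h''
  refine ⟨V', V'⁻¹ * x * V', fun i => (d i).arg, fun i =>
    ⟨(Complex.neg_pi_lt_arg _).le, Complex.arg_le_pi _⟩, ?_, by group⟩
  rw [hD]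
  congr 1
  funext i
  have h := Complex.norm_mul_exp_arg_mul_I (d i)
  rw [hnorm, Complex.ofReal_one, one_mul, mul_comm] at h
  exact h.symm

/-- Each of the `m` columns of the array of angles contributes at most `(2π)²` to the squared norm,
and each of the `r` leftover eigenvalues at most `4`. Dividing by `4N` and using `m / N ≤ 1 / k`
gives the bound. -/
theorem dist_diagonal_amplify_sq_le {N k : ℕ+} {m r : ℕ} (hN : (k : ℕ) * m + r = N)
    {D : UnitaryMetricGroup N} {θ : Fin N → ℝ} (hθ : ∀ i, θ i ∈ Set.Icc (-Real.pi) Real.pi)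
    (hD : D.toMatrix = Matrix.diagonal fun i => Complex.exp (Complex.I * θ i)) :
    ∃ (e : Fin N ≃ Fin k × Fin m ⊕ Fin r) (y : UnitaryMetricGroup k),
      dist D (amplify e y) ^ 2 ≤ Real.pi ^ 2 / (k : ℕ) + r / (N : ℕ) := by
  obtain ⟨e, τ, hτ, hsum⟩ := exists_equiv_sum_sub_le hN θ hθ (by linarith [Real.pi_pos])
  have hy : Matrix.diagonal (fun j => Complex.exp (Complex.I * τ j)) ∈
      Matrix.unitaryGroup (Fin k) ℂ := by
    rw [Matrix.mem_unitaryGroup_iff, Matrix.star_eq_conjTranspose, Matrix.diagonal_conjTranspose,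
      Matrix.diagonal_mul_diagonal, ← Matrix.diagonal_one]
    congr 1
    funext i
    rw [Pi.star_apply, Complex.star_def, Complex.mul_conj, Complex.normSq_eq_norm_sq,
      Complex.norm_exp_I_mul_ofReal]
    norm_num
  refine ⟨e, ofMatrix _ hy, ?_⟩
  rw [dist_sq, toMatrix_amplify, toMatrix_ofMatrix, Matrix.amplify_diagonal, hD,
    Matrix.diagonal_sub, hsNorm_diagonal_sq, ← e.symm.sum_comp]
  simp only [Fintype.sum_sum_type, Function.comp_apply, Equiv.apply_symm_apply, Sum.elim_inl,
    Sum.elim_inr, Fintype.sum_prod_type]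
  have h₁ : ∑ j : Fin k, ∑ l : Fin m, ‖Complex.exp (Complex.I * θ (e.symm (.inl (j, l)))) -
      Complex.exp (Complex.I * τ j)‖ ^ 2 ≤ m * (2 * Real.pi) ^ 2 := by
    rw [Finset.sum_comm]
    refine (Finset.sum_le_card_nsmul _ _ ((2 * Real.pi) ^ 2) fun l _ => ?_).trans_eq (by simp)
    calc ∑ j : Fin k, ‖Complex.exp (Complex.I * θ (e.symm (.inl (j, l)))) -
            Complex.exp (Complex.I * τ j)‖ ^ 2
        ≤ ∑ j : Fin k, 2 * Real.pi * (θ (e.symm (.inl (j, l))) - τ j) := by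
          -- The angle difference lies in `[0, 2π]`, so its square is at most `2π` times itself; the
          -- column sums of these differences are bounded by `hsum`.
          refine Finset.sum_le_sum fun j _ => ?_
          obtain ⟨h0, h2⟩ := hτ j l
          have h := Complex.norm_exp_I_mul_sub_exp_I_mul_le (θ (e.symm (.inl (j, l)))) (τ j)
          rw [abs_of_nonneg h0] at h
          refine (pow_le_pow_left₀ (norm_nonneg _) h 2).trans ?_
          nlinarith
      _ ≤ (2 * Real.pi) ^ 2 := by
          rw [← Finset.mul_sum]
          have := hsum l
          nlinarith [Real.pi_pos]
  have h₂ : ∑ i : Fin r, ‖Complex.exp (Complex.I * θ (e.symm (.inr i))) - 1‖ ^ 2 ≤ r * 4 := by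
    refine (Finset.sum_le_card_nsmul _ _ 4 fun i _ => ?_).trans_eq (by simp)
    have h : ‖Complex.exp (Complex.I * θ (e.symm (.inr i))) - 1‖ ≤ 2 := by
      refine (norm_sub_le _ _).trans_eq ?_
      rw [Complex.norm_exp_I_mul_ofReal, norm_one]
      norm_num
    nlinarith [norm_nonneg (Complex.exp (Complex.I * θ (e.symm (.inr i))) - 1)]
  have hN' : (k : ℝ) * m + r = (N : ℕ) := by exact_mod_cast hN
  have hN0 : (0 : ℝ) < (N : ℕ) := by exact_mod_cast N.pos
  have hk0 : (0 : ℝ) < (k : ℕ) := by exact_mod_cast k.pos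
  have h₃ : (m : ℝ) / (N : ℕ) ≤ 1 / (k : ℕ) := by
    rw [div_le_div_iff₀ hN0 hk0, ← hN']
    linarith [(Nat.cast_nonneg r : (0 : ℝ) ≤ r)]
  calc _ ≤ (m * (2 * Real.pi) ^ 2 + r * 4) / (4 * (N : ℕ)) := by gcongr
    _ = Real.pi ^ 2 * (m / (N : ℕ)) + r / (N : ℕ) := by field_simp; ring
    _ ≤ Real.pi ^ 2 * (1 / (k : ℕ)) + r / (N : ℕ) := by gcongr
    _ = _ := by ring

/-- Every element of `U_N` is close to the image of an element of `U_k` under an almost isometric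
homomorphism, when `k` and `N / k` are large. -/
theorem exists_monoidHom_dist_sq_le (k N : ℕ+) (x : UnitaryMetricGroup N) :
    ∃ (h : UnitaryMetricGroup k →* UnitaryMetricGroup N) (y : UnitaryMetricGroup k),
      (∀ a b, |dist (h a) (h b) - dist a b| ≤ (k : ℕ) / (N : ℕ)) ∧
      dist x (h y) ^ 2 ≤ Real.pi ^ 2 / (k : ℕ) + (k : ℕ) / (N : ℕ) := by
  have hN : (k : ℕ) * (N / k) + N % k = N := Nat.div_add_mod _ _
  have hr : ((N % k : ℕ) : ℝ) / (N : ℕ) ≤ (k : ℕ) / (N : ℕ) := by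
    gcongr
    exact (Nat.mod_lt _ k.pos).le
  obtain ⟨V, D, θ, hθ, hD, rfl⟩ := x.exists_eq_conj_diagonal
  obtain ⟨e, y, hy⟩ := dist_diagonal_amplify_sq_le hN hθ hD
  -- Conjugation by `V` is an isometry and takes `D` to the given unitary, so it preserves both
  -- estimates.
  refine ⟨(MulAut.conj V).toMonoidHom.comp (amplify e), y, fun a b => ?_, ?_⟩
  · simp only [MonoidHom.comp_apply, MulEquiv.toMonoidHom_eq_coe, MonoidHom.coe_coe,
      MulAut.conj_apply, BiInvMetricGroup.dist_mul_right', BiInvMetricGroup.dist_mul_left']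
    exact (abs_dist_amplify_sub_dist_le e hN a b).trans hr
  · simp only [MonoidHom.comp_apply, MulEquiv.toMonoidHom_eq_coe, MonoidHom.coe_coe,
      MulAut.conj_apply, BiInvMetricGroup.dist_mul_right', BiInvMetricGroup.dist_mul_left']
    exact hy.trans (by gcongr)

end UnitaryMetricGroup
/-! ### Convergence of the values of `Σ₂` sentences -/

theorem PNat.tendsto_const_div_atTop (c : ℝ) :
    Tendsto (fun k : ℕ+ => c / ((k : ℕ) : ℝ)) atTop (𝓝 0) :=
  (tendsto_const_div_atTop_nhds_zero_nat c).comp tendsto_PNat_val_atTop_atTop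

theorem MetricFormula.IsQuantifierFree.eventually_value_le {n : ℕ} {ψ : MetricFormula (1 + n)}
    (hψ : ψ.IsQuantifierFree) {ε : ℝ} (hε : 0 < ε) :
    ∀ᶠ k : ℕ+ in atTop, ∀ᶠ N : ℕ+ in atTop,
      ((MetricFormula.inf (.sups n ψ)).value (UnitaryMetricGroup k) : ℝ) ≤
        (MetricFormula.inf (.sups n ψ)).value (UnitaryMetricGroup N) + ε := by
  -- One `δ` serves as the bound on `dist x (h y)` and on the metric distortion of `h`; each of the
  -- two errors costs `ε / 2`.
  obtain ⟨δ, hδ, hcont, hhom⟩ := (eventually_mem_nhdsWithin.and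
    (((MetricFormula.sups n ψ).eventually_dist_eval_le (half_pos hε)).and
      (hψ.eventually_eval_sups_le (half_pos hε)))).exists
  replace hδ : 0 < δ := hδ
  filter_upwards [(PNat.tendsto_const_div_atTop (Real.pi ^ 2)).eventually_lt_const
    (half_pos (pow_pos hδ 2))] with k hk
  filter_upwards [(PNat.tendsto_const_div_atTop (k : ℕ)).eventually_lt_const
    (half_pos (pow_pos hδ 2)), (PNat.tendsto_const_div_atTop (k : ℕ)).eventually_lt_const hδ]
    with N hN hN'
  refine unitInterval.coe_iInf_le_add hε.le fun x => ?_
  obtain ⟨h, y, hh, hxy⟩ := UnitaryMetricGroup.exists_monoidHom_dist_sq_le k N x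
  refine ⟨y, ?_⟩
  have h₁ := hhom _ _ h (fun a b => (hh a b).trans hN'.le) (Fin.snoc Fin.elim0 y)
  have hdist : Dist.dist x (h y) ≤ δ := le_of_sq_le_sq (by linarith) hδ.le
  have h₂ := unitInterval.le_add_of_dist_le (hcont _ (h ∘ Fin.snoc Fin.elim0 y)
    (Fin.snoc Fin.elim0 x) fun i => by
      rw [Subsingleton.elim i (Fin.last 0), Function.comp_apply, Fin.snoc_last, Fin.snoc_last,
        dist_comm]
      exact hdist)
  linarith

/-- Otherwise `u` is frequently below some `a` and frequently above some `b > a`. Picking `k` with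
`u k > b`, then `N` with `u N < a`, contradicts the hypothesis for `ε = b - a`. -/
theorem unitInterval.exists_tendsto_of_eventually_eventually_le {ι : Type*} {f : Filter ι}
    {u : ι → unitInterval}
    (h : ∀ ε > 0, ∀ᶠ k in f, ∀ᶠ N in f, (u k : ℝ) ≤ u N + ε) : ∃ r, Tendsto u f (𝓝 r) := by
  refine tendsto_of_no_upcrossings dense_univ fun a _ b _ hab ⟨ha, hb⟩ => ?_
  have hε : (0 : ℝ) < b - a := sub_pos.mpr hab
  obtain ⟨k, hbk, hk⟩ := (hb.and_eventually (h _ hε)).exists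
  obtain ⟨N, haN, hN⟩ := (ha.and_eventually hk).exists
  have hbk' : (b : ℝ) < u k := hbk
  have haN' : (u N : ℝ) < a := haN
  linarith

theorem PNat.cofinite_le_atTop : (cofinite : Filter ℕ+) ≤ atTop := by
  refine le_iInf fun k => le_principal_iff.mpr ?_
  rw [mem_cofinite, Set.compl_Ici]
  exact Set.finite_Iio k

theorem mainTheorem6 :
    (∀ (n : ℕ) (ψ : MetricFormula (1 + n)), ψ.IsQuantifierFree →
      ∃ r : unitInterval,
        Tendsto (fun k : ℕ+ => (MetricFormula.inf (.sups n ψ)).value (UnitaryMetricGroup k))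
          atTop (𝓝 r)) ∧
    (∀ 𝒰 𝒱 : Ultrafilter ℕ+, (𝒰 : Filter ℕ+) ≤ cofinite → (𝒱 : Filter ℕ+) ≤ cofinite →
      SameSigmaTwoTheory (UniversalHyperlinearGroup 𝒰) (UniversalHyperlinearGroup 𝒱)) := by
  have hconv : ∀ (n : ℕ) (ψ : MetricFormula (1 + n)), ψ.IsQuantifierFree →
      ∃ r : unitInterval,
        Tendsto (fun k : ℕ+ => (MetricFormula.inf (.sups n ψ)).value (UnitaryMetricGroup k))
          atTop (𝓝 r) := fun n ψ hψ =>
    unitInterval.exists_tendsto_of_eventually_eventually_le fun ε hε => hψ.eventually_value_le hε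
  refine ⟨hconv, ?_⟩
  rintro 𝒰 𝒱 h𝒰 h𝒱 _ ⟨n, ψ, hψ, rfl⟩
  obtain ⟨r, hr⟩ := hconv n ψ hψ
  have key : ∀ 𝒲 : Ultrafilter ℕ+, (𝒲 : Filter ℕ+) ≤ cofinite →
      (MetricFormula.inf (.sups n ψ)).value (UniversalHyperlinearGroup 𝒲) = r := fun 𝒲 h𝒲 =>
    tendsto_nhds_unique (MetricFormula.tendsto_value_ultraproduct 𝒲 UnitaryMetricGroup _)
      (hr.mono_left (h𝒲.trans PNat.cofinite_le_atTop))
  rw [key 𝒰 h𝒰, key 𝒱 h𝒱]
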